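/- **Lemma 4.5 (Bousfield localization and Quillen equivalences).** Let $C$ and $D$ be simplicial model categories, and assume that $C$ is tractable. Let $L : C \rightleftarrows D : R$ be an adjunction $L\dashv R$ of the underlying ordinary categories (not necessarily a simplicial adjunction) which is a Quillen equivalence. Let $C'$ and $D'$ be left Bousfield localizations of $C$ and $D$ respectively. Assume that an object $d\in D$ which is fibrant in $D$ is fibrant in $D'$ if and only if $R(d)$ is fibrant in $C'$. Then $L\dashv R$ is a Quillen equivalence between $C'$ and $D'$. Here a *simplicial model category* is a model category enriched, tensored and cotensored over simplicial sets such that for every cofibration $i:A\to B$ and every fibration $p:X\to Y$ the map $$\mathrm{Map}(B,X)\to \mathrm{Map}(A,X)\times_{\mathrm{Map}(A,Y)}\mathrm{Map}(B,Y)$$ is a Kan fibration, and a trivial Kan fibration if moreover $i$ or $p$ is a weak equivalence. A model category is *tractable* if its underlying category is locally presentable and it admits a set of generating cofibrations and a set of generating trivial cofibrations, all of whose members have cofibrant domains and codomains. A *left Bousfield localization* of a model category is a model structure on the same category with the same cofibrations in which every weak equivalence of the original structure is still a weak equivalence. An adjunction $L\dashv R$ between model categories is a *Quillen equivalence* if $L$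 preserves cofibrations and trivial cofibrations and, for every cofibrant $c$ and fibrant $d$, a map $L(c)\to d$ is a weak equivalence if and only if its adjoint $c\to R(d)$ is one. -/

import Mathlib

open CategoryTheory Limits HomotopicalAlgebra MonoidalCategory

universe v u v₁ u₁ v₂ u₂

namespace BousfieldQuillen

/-! Several model structures are considered on one and the same category, so a model structure
is passed as an explicit argument `M : ModelCategory C`. -/

section ModelStructures

variable {C : Type u} [Category.{v} C]

/-- The object `X` is fibrant in the model structure `M`: the map `X ⟶ ⊤_ C` is a fibration. -/
def Fib (M : ModelCategory C) (X : C) : Prop :=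
  IsFibrant X

/-- The object `X` is cofibrant in the model structure `M`: the map `⊥_ C ⟶ X` is a
cofibration. -/
def Cof (M : ModelCategory C) (X : C) : Prop :=
  IsCofibrant X

/-- The model structure `M'` is a left Bousfield localization of the model structure `M` on the
same category: it has the same cofibrations and at least the same weak equivalences. -/
structure IsLeftBousfieldLocalization (M M' : ModelCategory C) : Prop where
  cofibrations_eq :
    @cofibrations C _ M'.categoryWithCofibrations = @cofibrations C _ M.categoryWithCofibrations
  weakEquivalences_le :
    @weakEquivalences C _ M.categoryWithWeakEquivalences ≤
      @weakEquivalences C _ M'.categoryWithWeakEquivalences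

/-- A model category is tractable if it is combinatorial (its underlying category is locally
presentable, and there are sets `I` of generating cofibrations and `J` of generating trivial
cofibrations), where moreover `I` and `J` can be chosen such that all their members have
cofibrant domains and codomains. All objects of a locally presentable category being small, the
smallness of the domains of `I` and `J` is automatic. -/
structure IsTractable (M : ModelCategory C) : Prop where
  locallyPresentable : IsLocallyPresentable.{v} C
  exists_generating_cofibrations :
    ∃ I : MorphismProperty C, MorphismProperty.IsSmall.{v} I ∧
      trivialFibrations C = I.rlp ∧
      ∀ ⦃A B : C⦄ (i : A ⟶ B), I i → Cof M A ∧ Cof M B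
  exists_generating_trivialCofibrations :
    ∃ J : MorphismProperty C, MorphismProperty.IsSmall.{v} J ∧
      fibrations C = J.rlp ∧
      ∀ ⦃A B : C⦄ (j : A ⟶ B), J j → Cof M A ∧ Cof M B

end ModelStructures

section Simplicial

open SimplicialCategory

variable {C : Type u} [Category.{v} C] [SimplicialCategory C]

/-- The map `sHom T Z ⟶ [K, sHom X Z]` induced by `η : K ⟶ sHom X T`. -/
noncomputable def tensorComparison {K : SSet.{v}} {X T : C} (η : K ⟶ sHom X T) (Z : C) :
    sHom T Z ⟶ (ihom K).obj (sHom X Z) :=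
  MonoidalClosed.curry ((η ▷ sHom T Z) ≫ sHomComp X T Z)

/-- The map `sHom Z P ⟶ [K, sHom Z X]` induced by `ε : K ⟶ sHom P X`. -/
noncomputable def cotensorComparison {K : SSet.{v}} {X P : C} (ε : K ⟶ sHom P X) (Z : C) :
    sHom Z P ⟶ (ihom K).obj (sHom Z X) :=
  MonoidalClosed.curry ((β_ K (sHom Z P)).hom ≫ (sHom Z P ◁ ε) ≫ sHomComp Z P X)

/-- For `i : A ⟶ B` and `p : X ⟶ Y`, the map
`sHom B X ⟶ sHom A X ×_{sHom A Y} sHom B Y` given by precomposition with `i` and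
postcomposition with `p`. -/
noncomputable def pullbackHom {A B X Y : C} (i : A ⟶ B) (p : X ⟶ Y) :
    sHom B X ⟶ pullback (eHomWhiskerLeft SSet.{v} A p) (eHomWhiskerRight SSet.{v} i Y) :=
  pullback.lift (eHomWhiskerRight SSet.{v} i X) (eHomWhiskerLeft SSet.{v} B p)
    (eHom_whisker_exchange SSet.{v} i p).symm

/-- The class of Kan fibrations: right lifting property against all horn inclusions. -/
def kanFibrations : MorphismProperty SSet.{v} :=
  SSet.modelCategoryQuillen.J.rlp

/-- The class of trivial Kan fibrations: right lifting property against all boundary inclusions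
`∂Δ[n] ⟶ Δ[n]`. -/
def trivialKanFibrations : MorphismProperty SSet.{v} :=
  SSet.modelCategoryQuillen.I.rlp

/-- The model structure `M` on the simplicial category `C` makes `C` a simplicial model category:
`C` is tensored and cotensored over simplicial sets (in the enriched sense), and the
pullback-hom axiom holds. -/
structure IsSimplicialModelCategory (M : ModelCategory C) : Prop where
  exists_tensor (K : SSet.{v}) (X : C) :
    ∃ (T : C) (η : K ⟶ sHom X T), ∀ Z : C, IsIso (tensorComparison η Z)
  exists_cotensor (K : SSet.{v}) (X : C) :
    ∃ (P : C) (ε : K ⟶ sHom P X), ∀ Z : C, IsIso (cotensorComparison ε Z)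
  kanFibration {A B X Y : C} (i : A ⟶ B) (p : X ⟶ Y) :
    cofibrations C i → fibrations C p → kanFibrations (pullbackHom i p)
  trivialKanFibration_left {A B X Y : C} (i : A ⟶ B) (p : X ⟶ Y) :
    trivialCofibrations C i → fibrations C p → trivialKanFibrations (pullbackHom i p)
  trivialKanFibration_right {A B X Y : C} (i : A ⟶ B) (p : X ⟶ Y) :
    cofibrations C i → trivialFibrations C p → trivialKanFibrations (pullbackHom i p)

end Simplicial

section Quillen

variable {C : Type u₁} [Category.{v₁} C] {D : Type u₂} [Category.{v₂} D]
  {L : C ⥤ D} {R : D ⥤ C}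

/-- An adjunction `L ⊣ R` is a Quillen adjunction with respect to the model structures `M`
and `N` if `L` preserves cofibrations and trivial cofibrations. -/
structure IsQuillenAdjunction (M : ModelCategory C) (N : ModelCategory D)
    (adj : L ⊣ R) : Prop where
  map_cofibration {A B : C} (i : A ⟶ B) : cofibrations C i → cofibrations D (L.map i)
  map_trivialCofibration {A B : C} (i : A ⟶ B) :
    trivialCofibrations C i → trivialCofibrations D (L.map i)

/-- A Quillen adjunction `L ⊣ R` is a Quillen equivalence if, for `c` cofibrant and `d` fibrant, a
map `L.obj c ⟶ d` is a weak equivalence if and only if its adjoint `c ⟶ R.obj d` is. -/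
structure IsQuillenEquivalence (M : ModelCategory C) (N : ModelCategory D)
    (adj : L ⊣ R) : Prop extends IsQuillenAdjunction M N adj where
  weakEquivalence_iff {c : C} {d : D} (hc : Cof M c) (hd : Fib N d) (f : L.obj c ⟶ d) :
    weakEquivalences D f ↔ weakEquivalences C (adj.homEquiv c d f)

end Quillen

end BousfieldQuillen

/-! Call a notion local if it refers to `M'` or `N'`. Between local fibrant objects, weak
equivalences and fibrations are local exactly when they are so originally. Since `R` preserves local
fibrant objects, it thus preserves local fibrations between them, which suffices for a Quillen
adjunction. For the equivalence, a local trivial cofibration replaces `c` by a cofibrant, local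
fibrant `c'`. It remains to see that `L.obj c' ⟶ d` and its adjoint are local weak equivalences only
if they are weak equivalences. For the adjoint this is clear. For the map itself, a fibrant
replacement `F` of `L.obj c'` must be local fibrant: the derived unit `c' ⟶ R.obj F` is a weak
equivalence, so `R.obj F` is local fibrant, and the hypothesis reflects this to `F`. -/

namespace BousfieldQuillen

/-! ### Generalities on a single model structure -/

section ModelStructure

variable {C : Type u} [Category.{v} C]

/-- The weak equivalences of the model structure `M`. -/
abbrev Weq (M : ModelCategory C) : MorphismProperty C := weakEquivalences C

/-- The cofibrations of the model structure `M`. -/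
abbrev Cofs (M : ModelCategory C) : MorphismProperty C := cofibrations C

/-- The fibrations of the model structure `M`. -/
abbrev Fibs (M : ModelCategory C) : MorphismProperty C := fibrations C

/-- The trivial fibrations of the model structure `M`. -/
abbrev TrivFibs (M : ModelCategory C) : MorphismProperty C := trivialFibrations C

lemma Cofs.rlp (M : ModelCategory C) : (Cofs M).rlp = TrivFibs M :=
  cofibrations_rlp C

lemma Fibs.of_rlp (M : ModelCategory C) {X Y : C} {p : X ⟶ Y}
    (h : ∀ ⦃A B : C⦄ (i : A ⟶ B), Cofs M i → Weq M i → HasLiftingProperty i p) : Fibs M p := by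
  rw [Fibs, ← trivialCofibrations_rlp]
  exact fun A B i hi ↦ h i hi.1 hi.2

lemma fib_iff (M : ModelCategory C) [HasTerminal C] (X : C) :
    Fib M X ↔ Fibs M (terminal.from X) :=
  fibration_iff _

lemma cof_iff (M : ModelCategory C) [HasInitial C] (X : C) :
    Cof M X ↔ Cofs M (initial.to X) :=
  cofibration_iff _

lemma Weq.comp (M : ModelCategory C) {X Y Z : C} {f : X ⟶ Y} {g : Y ⟶ Z}
    (hf : Weq M f) (hg : Weq M g) : Weq M (f ≫ g) :=
  (weakEquivalences C).comp_mem _ _ hf hg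

lemma Weq.of_precomp (M : ModelCategory C) {X Y Z : C} {f : X ⟶ Y} {g : Y ⟶ Z}
    (hf : Weq M f) (hfg : Weq M (f ≫ g)) : Weq M g :=
  (weakEquivalences C).of_precomp _ _ hf hfg

lemma Weq.of_postcomp (M : ModelCategory C) {X Y Z : C} {f : X ⟶ Y} {g : Y ⟶ Z}
    (hg : Weq M g) (hfg : Weq M (f ≫ g)) : Weq M f :=
  (weakEquivalences C).of_postcomp _ _ hg hfg

lemma Weq.id (M : ModelCategory C) (X : C) : Weq M (𝟙 X) :=
  (weakEquivalences C).id_mem X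

lemma Cofs.hasLiftingProperty (M : ModelCategory C) {A B X Y : C} {i : A ⟶ B} {p : X ⟶ Y}
    (hi : Cofs M i) (hi' : Weq M i) (hp : Fibs M p) : HasLiftingProperty i p := by
  have : Cofibration i := ⟨hi⟩
  have : WeakEquivalence i := ⟨hi'⟩
  have : Fibration p := ⟨hp⟩
  infer_instance

lemma exists_trivialCofibration_fibration_factorization (M : ModelCategory C) {X Y : C}
    (f : X ⟶ Y) :
    ∃ (Z : C) (i : X ⟶ Z) (p : Z ⟶ Y), Cofs M i ∧ Weq M i ∧ Fibs M p ∧ i ≫ p = f := by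
  let h := MorphismProperty.factorizationData (trivialCofibrations C) (fibrations C) f
  exact ⟨h.Z, h.i, h.p, h.hi.1, h.hi.2, h.hp, h.fac⟩

lemma Fib.of_fibration (M : ModelCategory C) {X Y : C} {p : X ⟶ Y} (hp : Fibs M p)
    (hY : Fib M Y) : Fib M X := by
  have : Fibration p := ⟨hp⟩
  have : IsFibrant Y := hY
  exact isFibrant_of_fibration p

lemma Cof.of_cofibration (M : ModelCategory C) {X Y : C} {i : X ⟶ Y} (hi : Cofs M i)
    (hX : Cof M X) : Cof M Y := by
  have : Cofibration i := ⟨hi⟩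
  have : IsCofibrant X := hX
  exact isCofibrant_of_cofibration i

lemma exists_fibrant_replacement (M : ModelCategory C) (X : C) :
    ∃ (Y : C) (i : X ⟶ Y), Cofs M i ∧ Weq M i ∧ Fib M Y := by
  obtain ⟨Y, i, p, hi, hi', hp, fac⟩ :=
    exists_trivialCofibration_fibration_factorization M (terminal.from X)
  obtain rfl : p = terminal.from Y := Subsingleton.elim _ _
  exact ⟨Y, i, hi, hi', ⟨hp⟩⟩

lemma Fib.exists_extension (M : ModelCategory C) {X : C} (hX : Fib M X) {A B : C} {i : A ⟶ B}
    (hi : Cofs M i) (hi' : Weq M i) (f : A ⟶ X) : ∃ g : B ⟶ X, i ≫ g = f := by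
  have := Cofs.hasLiftingProperty M hi hi' hX.mem
  have sq : CommSq f i (terminal.from X) (terminal.from B) := ⟨Subsingleton.elim _ _⟩
  exact ⟨sq.lift, sq.fac_left⟩

lemma Fib.of_exists_extension (M : ModelCategory C) {X : C}
    (h : ∀ ⦃A B : C⦄ (i : A ⟶ B), Cofs M i → Weq M i → ∀ f : A ⟶ X, ∃ g : B ⟶ X, i ≫ g = f) :
    Fib M X := by
  refine ⟨Fibs.of_rlp M fun A B i hi hi' ↦ ⟨fun {f g} sq ↦ ?_⟩⟩
  obtain ⟨l, hl⟩ := h i hi hi' f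
  exact ⟨⟨⟨l, hl, Subsingleton.elim _ _⟩⟩⟩

lemma Fib.of_retract (M : ModelCategory C) {X Y : C} (s : X ⟶ Y) (r : Y ⟶ X)
    (hsr : s ≫ r = 𝟙 X) (hY : Fib M Y) : Fib M X :=
  Fib.of_exists_extension M fun A B i hi hi' f ↦ by
    obtain ⟨g, hg⟩ := hY.exists_extension M hi hi' (f ≫ s)
    exact ⟨g ≫ r, by rw [← Category.assoc, hg, Category.assoc, hsr, Category.comp_id]⟩

/-- Ken Brown's factorization of a weak equivalence between fibrant objects as a section of a
trivial fibration followed by a trivial fibration. -/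
lemma Weq.exists_brown_factorization (M : ModelCategory C) {X Y : C} (hX : Fib M X)
    (hY : Fib M Y) {f : X ⟶ Y} (hf : Weq M f) :
    ∃ (Z : C) (i : X ⟶ Z) (p : Z ⟶ Y) (r : Z ⟶ X), i ≫ p = f ∧ i ≫ r = 𝟙 X ∧
      TrivFibs M p ∧ TrivFibs M r := by
  have : IsFibrant X := hX
  have : IsFibrant Y := hY
  have : WeakEquivalence f := ⟨hf⟩
  obtain ⟨h⟩ : Nonempty (FibrantBrownFactorization f) := inferInstance
  exact ⟨h.Z, h.i, h.p, h.r, h.fac, h.i_r, mem_trivialFibrations _, mem_trivialFibrations _⟩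

/-- A cofibration with the left lifting property against all fibrations between fibrant objects
is a weak equivalence. -/
lemma weq_of_lifting_against_fibrations_between_fibrant (M : ModelCategory C) {A B : C}
    (u : A ⟶ B)
    (h : ∀ ⦃X Y : C⦄ (p : X ⟶ Y), Fib M X → Fib M Y → Fibs M p → HasLiftingProperty u p) :
    Weq M u := by
  obtain ⟨B', v, hv, hv', hB'⟩ := exists_fibrant_replacement M B
  obtain ⟨A', j, q, hj, hj', hq, fac⟩ :=
    exists_trivialCofibration_fibration_factorization M (u ≫ v)
  have := h q (hB'.of_fibration M hq) hB' hq
  have sq : CommSq j u q v := ⟨fac⟩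
  -- The lift `B ⟶ A'` is extended along `v` to a section of `q`, so that the retraction below fixes
  -- `B'`.
  have := Cofs.hasLiftingProperty M hv hv' hq
  have sq' : CommSq sq.lift v q (𝟙 B') := ⟨by simp⟩
  -- `u ≫ v` is a retract of `j`
  have ret : RetractArrow (u ≫ v) j :=
    { i := Arrow.homMk (𝟙 A) sq'.lift (by simp)
      r := Arrow.homMk (𝟙 A) q (by simp [fac])
      retract := by ext <;> simp }
  exact Weq.of_postcomp M hv' ((weakEquivalences C).of_retract ret hj')

end ModelStructure

/-! ### Local versus original fibrations and weak equivalences -/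

section Localization

variable {C : Type u} [Category.{v} C] {M M' : ModelCategory C}

namespace IsLeftBousfieldLocalization

lemma cofs_iff (h : IsLeftBousfieldLocalization M M') {X Y : C} (f : X ⟶ Y) :
    Cofs M' f ↔ Cofs M f := by
  rw [Cofs, Cofs, h.cofibrations_eq]

lemma weq (h : IsLeftBousfieldLocalization M M') {X Y : C} {f : X ⟶ Y} (hf : Weq M f) :
    Weq M' f :=
  h.weakEquivalences_le _ hf

lemma cof_iff (h : IsLeftBousfieldLocalization M M') (X : C) : Cof M' X ↔ Cof M X :=
  have := M.cm1b
  (BousfieldQuillen.cof_iff M' X).trans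
    ((h.cofs_iff _).trans (BousfieldQuillen.cof_iff M X).symm)

/-- Trivial fibrations are determined by the cofibrations through lifting. -/
lemma trivialFibrations_eq (h : IsLeftBousfieldLocalization M M') :
    TrivFibs M' = TrivFibs M := by
  rw [← Cofs.rlp, ← Cofs.rlp, Cofs, Cofs, h.cofibrations_eq]

lemma fibs (h : IsLeftBousfieldLocalization M M') {X Y : C} {p : X ⟶ Y} (hp : Fibs M' p) :
    Fibs M p :=
  Fibs.of_rlp M fun _ _ i hi hi' ↦
    Cofs.hasLiftingProperty M' ((h.cofs_iff i).2 hi) (h.weq hi') hp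

lemma fib (h : IsLeftBousfieldLocalization M M') {X : C} (hX : Fib M' X) : Fib M X :=
  have := M.cm1a
  (fib_iff M X).2 (h.fibs ((fib_iff M' X).1 hX))

/-- A local weak equivalence between local fibrant objects is a weak equivalence. -/
lemma weq_of_fib (h : IsLeftBousfieldLocalization M M') {X Y : C} (hX : Fib M' X)
    (hY : Fib M' Y) {f : X ⟶ Y} (hf : Weq M' f) : Weq M f := by
  obtain ⟨Z, i, p, r, rfl, fac, hp, hr⟩ := hf.exists_brown_factorization M' hX hY
  rw [h.trivialFibrations_eq] at hp hr
  exact Weq.comp M (Weq.of_postcomp M hr.2 (fac ▸ Weq.id M X)) hp.2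

/-- A fibration between local fibrant objects is a local fibration. -/
lemma fibs_of_fib (h : IsLeftBousfieldLocalization M M') {X Y : C} (hX : Fib M' X)
    (hY : Fib M' Y) {p : X ⟶ Y} (hp : Fibs M p) : Fibs M' p := by
  obtain ⟨Z, i, q, hi, hi', hq, fac⟩ := exists_trivialCofibration_fibration_factorization M' p
  -- `Z` is local fibrant, so `i` is an original trivial cofibration; lifting it against `p` makes
  -- `p` a retract of `q`.
  have := Cofs.hasLiftingProperty M ((h.cofs_iff i).1 hi)
    (h.weq_of_fib hX (hY.of_fibration M' hq) hi') hp
  exact (Fibs M').of_retract (RetractArrow.ofRightLiftingProperty fac) hq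

/-- A fibrant object which receives a weak equivalence from a local fibrant object is local
fibrant. -/
lemma fib_of_weq (h : IsLeftBousfieldLocalization M M') {X Y : C} (hX : Fib M' X)
    (hY : Fib M Y) {f : X ⟶ Y} (hf : Weq M f) : Fib M' Y := by
  obtain ⟨Y', j, hj, hj', hY'⟩ := exists_fibrant_replacement M' Y
  -- `f ≫ j` joins local fibrant objects, so two-out-of-three applies in `M`; then `j` splits
  -- because `Y` is fibrant.
  have hj'' : Weq M j :=
    Weq.of_precomp M hf (h.weq_of_fib hX hY' (Weq.comp M' (h.weq hf) hj'))
  obtain ⟨r, hr⟩ := hY.exists_extension M ((h.cofs_iff j).1 hj) hj'' (𝟙 Y)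
  exact hY'.of_retract M' j r hr

end IsLeftBousfieldLocalization

end Localization

/-! ### Quillen adjunctions and equivalences under localization -/

section Quillen

variable {C : Type u₁} [Category.{v₁} C] {D : Type u₂} [Category.{v₂} D]
  {L : C ⥤ D} {R : D ⥤ C} {adj : L ⊣ R}

namespace IsQuillenAdjunction

variable {M : ModelCategory C} {N : ModelCategory D}

lemma map_fibration (h : IsQuillenAdjunction M N adj) {X Y : D} {p : X ⟶ Y} (hp : Fibs N p) :
    Fibs M (R.map p) := by
  refine Fibs.of_rlp M fun A B i hi hi' ↦ ?_
  have hLi := h.map_trivialCofibration i ⟨hi, hi'⟩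
  rw [← adj.hasLiftingProperty_iff]
  exact Cofs.hasLiftingProperty N hLi.1 hLi.2 hp

lemma fib_obj (h : IsQuillenAdjunction M N adj) {X : D} (hX : Fib N X) : Fib M (R.obj X) :=
  Fib.of_exists_extension M fun A B i hi hi' f ↦ by
    have hLi := h.map_trivialCofibration i ⟨hi, hi'⟩
    obtain ⟨g, hg⟩ := hX.exists_extension N hLi.1 hLi.2 ((adj.homEquiv A X).symm f)
    exact ⟨adj.homEquiv B X g, by
      rw [← adj.homEquiv_naturality_left, hg, Equiv.apply_symm_apply]⟩

/-- An adjunction whose left adjoint preserves cofibrations and whose right adjoint preserves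
fibrations between fibrant objects is a Quillen adjunction. -/
lemma of_fibrations_between_fibrant
    (hL : ∀ ⦃A B : C⦄ (i : A ⟶ B), Cofs M i → Cofs N (L.map i))
    (hR : ∀ ⦃X Y : D⦄ (p : X ⟶ Y), Fib N X → Fib N Y → Fibs N p → Fibs M (R.map p)) :
    IsQuillenAdjunction M N adj where
  map_cofibration i hi := hL i hi
  map_trivialCofibration i hi :=
    ⟨hL i hi.1, weq_of_lifting_against_fibrations_between_fibrant N _ fun X Y p hX hY hp ↦ by
      rw [adj.hasLiftingProperty_iff]
      exact Cofs.hasLiftingProperty M hi.1 hi.2 (hR p hX hY hp)⟩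

end IsQuillenAdjunction

variable {M M' : ModelCategory C} {N N' : ModelCategory D}

lemma IsQuillenAdjunction.localization (h : IsQuillenAdjunction M N adj)
    (hM' : IsLeftBousfieldLocalization M M') (hN' : IsLeftBousfieldLocalization N N')
    (hR : ∀ d : D, Fib N' d → Fib M' (R.obj d)) : IsQuillenAdjunction M' N' adj :=
  .of_fibrations_between_fibrant
    (fun _ _ i hi ↦ (hN'.cofs_iff _).2 (h.map_cofibration i ((hM'.cofs_iff i).1 hi)))
    fun X Y _ hX hY hp ↦ hM'.fibs_of_fib (hR X hX) (hR Y hY) (h.map_fibration (hN'.fibs hp))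

/-- If `c` is cofibrant and local fibrant, then a local weak equivalence from `L.obj c` to a local
fibrant object is a weak equivalence. -/
lemma IsQuillenEquivalence.weq_of_fib (h : IsQuillenEquivalence M N adj)
    (hM' : IsLeftBousfieldLocalization M M') (hN' : IsLeftBousfieldLocalization N N')
    (hR : ∀ d : D, Fib N d → Fib M' (R.obj d) → Fib N' d) {c : C} {d : D}
    (hc : Cof M c) (hc' : Fib M' c) (hd : Fib N' d) {g : L.obj c ⟶ d} (hg : Weq N' g) :
    Weq N g := by
  obtain ⟨F, j, hj, hj', hF⟩ := exists_fibrant_replacement N (L.obj c)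
  have hF' : Fib N' F := hR F hF <|
    hM'.fib_of_weq hc' (h.fib_obj hF) ((h.weakEquivalence_iff hc hF j).1 hj')
  -- This reduces `g` to a map `k` between the local fibrant objects `F` and `d`.
  obtain ⟨k, rfl⟩ := (hN'.fib hd).exists_extension N hj hj' g
  exact Weq.comp N hj' (hN'.weq_of_fib hF' hd (Weq.of_precomp N' (hN'.weq hj') hg))

theorem IsQuillenEquivalence.localization (h : IsQuillenEquivalence M N adj)
    (hM' : IsLeftBousfieldLocalization M M') (hN' : IsLeftBousfieldLocalization N N')
    (hR : ∀ d : D, Fib N d → (Fib N' d ↔ Fib M' (R.obj d))) :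
    IsQuillenEquivalence M' N' adj := by
  have hR' (d : D) (hd : Fib N' d) : Fib M' (R.obj d) := (hR d (hN'.fib hd)).1 hd
  have hadj := h.toIsQuillenAdjunction.localization hM' hN' hR'
  refine ⟨hadj, fun {c d} hc hd f ↦ ?_⟩
  obtain ⟨c', i, p, hi, hi', hp, fac⟩ :=
    exists_trivialCofibration_fibration_factorization M' (adj.homEquiv c d f)
  obtain ⟨g, rfl⟩ := (adj.homEquiv c' d).surjective p
  have hc₁ : Cof M c' := (hM'.cof_iff c').1 (hc.of_cofibration M' hi)
  have hc₂ : Fib M' c' := (hR' d hd).of_fibration M' hp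
  obtain rfl : L.map i ≫ g = f := (adj.homEquiv c d).injective
    (by rw [adj.homEquiv_naturality_left, fac])
  have hLi : Weq N' (L.map i) := (hadj.map_trivialCofibration i ⟨hi, hi'⟩).2
  -- By two-out-of-three along `i` and `L.map i`, only `g` and its adjoint matter from here on.
  have key := h.weakEquivalence_iff hc₁ (hN'.fib hd) g
  rw [adj.homEquiv_naturality_left]
  constructor
  · intro hf
    exact Weq.comp M' hi' (hM'.weq (key.1 (h.weq_of_fib hM' hN' (fun d hd ↦ (hR d hd).2)
      hc₁ hc₂ hd (Weq.of_precomp N' hLi hf))))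
  · intro hf
    exact Weq.comp N' hLi (hN'.weq (key.2 (hM'.weq_of_fib hc₂ (hR' d hd)
      (Weq.of_precomp M' hi' hf))))

end Quillen

end BousfieldQuillen



theorem lemma4p5
    {C : Type u₁} [Category.{v₁} C] [SimplicialCategory C]
    {D : Type u₂} [Category.{v₂} D] [SimplicialCategory D]
    (M M' : ModelCategory C) (N N' : ModelCategory D)
    (hM : BousfieldQuillen.IsSimplicialModelCategory M)
    (hN : BousfieldQuillen.IsSimplicialModelCategory N)
    (hMtract : BousfieldQuillen.IsTractable M)
    {L : C ⥤ D} {R : D ⥤ C} (adj : L ⊣ R)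
    (hadj : BousfieldQuillen.IsQuillenEquivalence M N adj)
    (hM' : BousfieldQuillen.IsLeftBousfieldLocalization M M')
    (hN' : BousfieldQuillen.IsLeftBousfieldLocalization N N')
    (hR : ∀ d : D, BousfieldQuillen.Fib N d →
      (BousfieldQuillen.Fib N' d ↔ BousfieldQuillen.Fib M' (R.obj d))) :
    BousfieldQuillen.IsQuillenEquivalence M' N' adj := by
  exact hadj.localization hM' hN' hR
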